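/- For $\pi\in S_n$ let $\mathrm{Des}(\pi)$ be the number of descents of $\pi$, i.e. of indices $1\le i\le n-1$ with $\pi(i)>\pi(i+1)$, and let $\mathrm{Inv}(\pi)$ be the number of inversions of $\pi$, i.e. of pairs $1\le i<j\le n$ with $\pi(i)>\pi(j)$. Let $P$ be the uniform probability distribution on $S_n$ and let $\Phi$ be the standard normal distribution function. There is a constant $C$, independent of $n$, such that for all real $x$ \[ \left| P\left\{ \frac{\mathrm{Des}-\frac{n-1}{2}}{\sqrt{\frac{n+1}{12}}} \le x \right\} - \Phi(x) \right| \le \frac{C}{n^{1/2}} \qquad (n\ge 1), \] \[ \left| P\left\{ \frac{\mathrm{Inv}-\frac{\binom n2}{2}}{\sqrt{\frac{n(n-1)(2n+5)}{72}}} \le x \right\} - \Phi(x) \right| \le \frac{C}{n^{1/2}} \qquad (n\ge 2). \] -/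

import Mathlib

open MeasureTheory ProbabilityTheory

/-- The number of descents of `π ∈ S_n`: the number of pairs `(i, i + 1)` of consecutive
positions with `π(i) > π(i + 1)`. Positions and values are numbered `0, …, n - 1`. -/
def descents {n : ℕ} (π : Equiv.Perm (Fin n)) : ℕ :=
  (Finset.univ.filter fun p : Fin n × Fin n =>
    (p.1 : ℕ) + 1 = (p.2 : ℕ) ∧ π p.2 < π p.1).card

/-- The number of inversions of `π ∈ S_n`: the number of pairs `(i, j)` of positions with
`i < j` and `π(i) > π(j)`. -/
def inversions {n : ℕ} (π : Equiv.Perm (Fin n)) : ℕ :=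
  (Finset.univ.filter fun p : Fin n × Fin n => p.1 < p.2 ∧ π p.2 < π p.1).card

/-- Every subset of the finite group `S_n` is an event. -/
instance permMeasurableSpace (n : ℕ) : MeasurableSpace (Equiv.Perm (Fin n)) := ⊤

/-- The uniform probability measure on `S_n`. -/
noncomputable def uniformPerm (n : ℕ) : Measure (Equiv.Perm (Fin n)) :=
  uniformOn Set.univ

/-- The distribution function `Φ` of the standard normal distribution. -/
noncomputable def stdNormalCDF (x : ℝ) : ℝ := cdf (gaussianReal 0 1) x

open Set Filter Topology

/-! Both statistics are compared with sums of independent bounded variables, and one Berry–Esseen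
bound serves both sums.

The bound is Stein's method with zero-bias couplings. The zero-bias transform `X*` of `X` satisfies
`E[(X - m) f(X)] = v E[f'(X*)]`. For an independent sum, it is obtained by replacing a single
summand, chosen with probability proportional to its variance; if each summand can be coupled within
`δ`, so can the sum (`HasZeroBias.conv`). Evaluating Stein's equation at `X*` puts the jump of the
indicator there, so only the increment of the locally Lipschitz function `w f(w)` between the
standardized `X` and `X*` has to be bounded. Returning from `X*` to `X` shifts the threshold by `δ`.
The total error is of order `δ / s`, plus a correction when `s ^ 2` exceeds the variance
(`HasZeroBias.abs_measureReal_Iic_sub_le`).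

Inserting the largest letter at a uniform position adds an independent uniform number of inversions.
Here `δ = n` and `s` has order `n ^ (3 / 2)`.

Descents are distributed as the integer part of a sum of `n` independent uniform variables on the
unit interval (`integral_descents`), so `δ = 1` and `s` has order `√n`. Insertion gives the Eulerian
recurrence. The sum obeys the same recurrence because, given integer part `k`, the mean of its
fractional part is `(n - k) / (n + 1)`, by exchangeability and a reflection of one summand. -/

lemma prod_measure_univ {α β : Type*} [MeasurableSpace α] [MeasurableSpace β] (μ : Measure α)
    (ν : Measure β) [SFinite ν] : μ.prod ν Set.univ = μ Set.univ * ν Set.univ := by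
  rw [← Set.univ_prod_univ, Measure.prod_prod]

/-! ### Bounded laws, locally bounded test functions and convolution -/

/-- A measurable real function that is bounded on bounded sets. -/
structure MeasLocBdd (φ : ℝ → ℝ) : Prop where
  meas : Measurable φ
  bdd : ∀ R : ℝ, ∃ M : ℝ, ∀ x, |x| ≤ R → |φ x| ≤ M

namespace MeasLocBdd

lemma of_continuous {φ : ℝ → ℝ} (h : Continuous φ) : MeasLocBdd φ where
  meas := h.measurable
  bdd R := by
    obtain ⟨M, hM⟩ := (isCompact_Icc (a := -R) (b := R)).exists_bound_of_continuousOn h.continuousOn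
    exact ⟨M, fun x hx => hM x (abs_le.mp hx)⟩

lemma of_bounded {φ : ℝ → ℝ} (h : Measurable φ) {M : ℝ} (hM : ∀ x, |φ x| ≤ M) : MeasLocBdd φ :=
  ⟨h, fun _ => ⟨M, fun x _ => hM x⟩⟩

lemma mul {φ ψ : ℝ → ℝ} (hφ : MeasLocBdd φ) (hψ : MeasLocBdd ψ) :
    MeasLocBdd (fun x => φ x * ψ x) where
  meas := hφ.meas.mul hψ.meas
  bdd R := by
    obtain ⟨M, hM⟩ := hφ.bdd R
    obtain ⟨N, hN⟩ := hψ.bdd R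
    refine ⟨M * N, fun x hx => ?_⟩
    rw [abs_mul]
    exact mul_le_mul (hM x hx) (hN x hx) (abs_nonneg _) ((abs_nonneg _).trans (hM x hx))

lemma add {φ ψ : ℝ → ℝ} (hφ : MeasLocBdd φ) (hψ : MeasLocBdd ψ) :
    MeasLocBdd (fun x => φ x + ψ x) where
  meas := hφ.meas.add hψ.meas
  bdd R := by
    obtain ⟨M, hM⟩ := hφ.bdd R
    obtain ⟨N, hN⟩ := hψ.bdd R
    exact ⟨M + N, fun x hx => (abs_add_le _ _).trans (add_le_add (hM x hx) (hN x hx))⟩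

lemma comp_floor (h : ℤ → ℝ) : MeasLocBdd (fun x => h ⌊x⌋) where
  meas := (measurable_from_top (f := h)).comp Int.measurable_floor
  bdd R := by
    refine ⟨∑ k ∈ Finset.Icc ⌊-R⌋ ⌊R⌋, |h k|, fun x hx => ?_⟩
    refine Finset.single_le_sum (f := fun k => |h k|) (fun _ _ => abs_nonneg _) ?_
    rw [Finset.mem_Icc]
    exact ⟨Int.floor_mono (abs_le.mp hx).1, Int.floor_mono (abs_le.mp hx).2⟩

lemma integrable {φ : ℝ → ℝ} (hφ : MeasLocBdd φ) {α : Type*} [MeasurableSpace α] {μ : Measure α}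
    [IsFiniteMeasure μ] {X : α → ℝ} (hX : Measurable X) (hb : ∃ R : ℝ, ∀ᵐ a ∂μ, |X a| ≤ R) :
    Integrable (fun a => φ (X a)) μ := by
  obtain ⟨R, hR⟩ := hb
  obtain ⟨M, hM⟩ := hφ.bdd R
  exact Integrable.of_bound (hφ.meas.comp hX).aestronglyMeasurable M
    (hR.mono fun a ha => hM _ ha)

lemma integrable_mul {φ ψ : ℝ → ℝ} (hφ : MeasLocBdd φ) (hψ : MeasLocBdd ψ) {α : Type*}
    [MeasurableSpace α] {μ : Measure α} [IsFiniteMeasure μ] {X Y : α → ℝ} (hX : Measurable X)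
    (hY : Measurable Y) (hb : ∃ R : ℝ, ∀ᵐ a ∂μ, |X a| ≤ R) (hb' : ∃ R : ℝ, ∀ᵐ a ∂μ, |Y a| ≤ R) :
    Integrable (fun a => φ (X a) * ψ (Y a)) μ := by
  obtain ⟨R, hR⟩ := hb
  obtain ⟨M, hM⟩ := hφ.bdd R
  exact (hψ.integrable hY hb').bdd_mul (hφ.meas.comp hX).aestronglyMeasurable
    (hR.mono fun a ha => hM _ ha)

end MeasLocBdd

/-- The measure is concentrated on a bounded set. -/
def AEBounded (μ : Measure ℝ) : Prop := ∃ R : ℝ, ∀ᵐ x ∂μ, |x| ≤ R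

lemma AEBounded.fst {μ : Measure ℝ} (h : AEBounded μ) {β : Type*} [MeasurableSpace β]
    (ν : Measure β) [SFinite μ] [SFinite ν] : ∃ R : ℝ, ∀ᵐ p ∂(μ.prod ν), |p.1| ≤ R :=
  h.imp fun _ hR => Measure.quasiMeasurePreserving_fst.ae hR

lemma AEBounded.snd {μ : Measure ℝ} (h : AEBounded μ) {β : Type*} [MeasurableSpace β]
    (ν : Measure β) [SFinite μ] [SFinite ν] : ∃ R : ℝ, ∀ᵐ p ∂(ν.prod μ), |p.2| ≤ R :=
  h.imp fun _ hR => Measure.quasiMeasurePreserving_snd.ae hR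

lemma AEBounded.add_prod {μ ν : Measure ℝ} (hμ : AEBounded μ) (hν : AEBounded ν)
    [SFinite μ] [SFinite ν] : ∃ R : ℝ, ∀ᵐ p ∂(μ.prod ν), |p.1 + p.2| ≤ R := by
  obtain ⟨R, hR⟩ := hμ.fst ν
  obtain ⟨S, hS⟩ := hν.snd μ
  refine ⟨R + S, ?_⟩
  filter_upwards [hR, hS] with p h1 h2
  exact (abs_add_le _ _).trans (add_le_add h1 h2)

lemma AEBounded.conv {μ ν : Measure ℝ} (hμ : AEBounded μ) (hν : AEBounded ν)
    [SFinite μ] [SFinite ν] : AEBounded (μ ∗ ν) := by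
  obtain ⟨R, hR⟩ := hμ.add_prod hν
  refine ⟨R, ?_⟩
  rw [Measure.conv, ae_map_iff (by fun_prop) (measurableSet_le (by fun_prop) (by fun_prop))]
  exact hR

lemma MeasLocBdd.integral_conv {φ : ℝ → ℝ} (hφ : MeasLocBdd φ) {μ ν : Measure ℝ}
    [IsFiniteMeasure μ] [IsFiniteMeasure ν] (hμ : AEBounded μ) (hν : AEBounded ν) :
    ∫ x, φ x ∂(μ ∗ ν) = ∫ x, ∫ y, φ (x + y) ∂ν ∂μ := by
  rw [MeasureTheory.integral_conv]
  exact hφ.integrable measurable_id (hμ.conv hν)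

/-! ### Zero-bias couplings -/

/-- `g` is a bounded measurable derivative of `f`. -/
structure IsBddDeriv (f g : ℝ → ℝ) : Prop where
  meas : Measurable g
  bdd : ∃ M : ℝ, ∀ x, |g x| ≤ M
  sub_eq : ∀ a b, f b - f a = ∫ t in a..b, g t

namespace IsBddDeriv

variable {f g : ℝ → ℝ}

lemma abs_sub_le (h : IsBddDeriv f g) {M : ℝ} (hM : ∀ x, |g x| ≤ M) (a b : ℝ) :
    |f b - f a| ≤ M * |b - a| := by
  rw [h.sub_eq]
  exact intervalIntegral.norm_integral_le_of_norm_le_const (f := g) (C := M) fun x _ => hM x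

lemma continuous (h : IsBddDeriv f g) : Continuous f := by
  obtain ⟨M, hM⟩ := h.bdd
  have h0 : 0 ≤ M := (abs_nonneg _).trans (hM 0)
  refine (LipschitzWith.of_dist_le_mul (K := ⟨M, h0⟩) fun x y => ?_).continuous
  rw [Real.dist_eq, Real.dist_eq]
  exact h.abs_sub_le hM y x

lemma measLocBdd_deriv (h : IsBddDeriv f g) : MeasLocBdd g :=
  h.bdd.elim fun _ hM => .of_bounded h.meas hM

lemma comp_add_right (h : IsBddDeriv f g) (c : ℝ) :
    IsBddDeriv (fun x => f (x + c)) (fun x => g (x + c)) where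
  meas := h.meas.comp (measurable_add_const c)
  bdd := h.bdd.imp fun _ hM x => hM _
  sub_eq a b := by rw [h.sub_eq, intervalIntegral.integral_comp_add_right]

lemma comp_div (h : IsBddDeriv f g) {s : ℝ} (hs : s ≠ 0) (m : ℝ) :
    IsBddDeriv (fun x => f ((x - m) / s)) (fun x => g ((x - m) / s) / s) where
  meas := by
    have := h.meas
    fun_prop
  bdd := by
    obtain ⟨M, hM⟩ := h.bdd
    refine ⟨M / |s|, fun x => ?_⟩
    rw [abs_div]
    exact div_le_div_of_nonneg_right (hM _) (abs_nonneg _)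
  sub_eq a b := by
    rw [h.sub_eq, intervalIntegral.integral_div]
    have := intervalIntegral.integral_comp_div_sub (a := a) (b := b) g hs (m / s)
    simp only [← sub_div] at this
    rw [this, smul_eq_mul, mul_div_cancel_left₀ _ hs]

end IsBddDeriv

/-- `ν / v` is the law of a coupling of `μ`, a law with mean `m` and variance `v`, with its
zero-bias transform, the two coordinates being at distance at most `δ`. -/
structure IsZeroBiasCoupling (μ : Measure ℝ) (ν : Measure (ℝ × ℝ)) (m v δ : ℝ) : Prop where
  bdd : AEBounded μ
  finite : IsFiniteMeasure ν
  mass : ν.real Set.univ = v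
  map_fst : ν.map Prod.fst = ν Set.univ • μ
  close : ∀ᵐ p ∂ν, |p.1 - p.2| ≤ δ
  stein : ∀ f g : ℝ → ℝ, IsBddDeriv f g → ∫ x, (x - m) * f x ∂μ = ∫ p, g p.2 ∂ν

/-- `μ` has a zero-bias transform at distance at most `δ`. -/
def HasZeroBias (μ : Measure ℝ) (m v δ : ℝ) : Prop := ∃ ν, IsZeroBiasCoupling μ ν m v δ

lemma HasZeroBias.aeBounded {μ : Measure ℝ} {m v δ : ℝ} (h : HasZeroBias μ m v δ) :
    AEBounded μ := h.elim fun _ hν => hν.bdd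

lemma aeBounded_dirac (x : ℝ) : AEBounded (Measure.dirac x) :=
  ⟨|x|, by rw [ae_dirac_iff (measurableSet_le (by fun_prop) (by fun_prop))]⟩

lemma hasZeroBias_dirac_zero (δ : ℝ) : HasZeroBias (Measure.dirac 0) 0 0 δ := by
  refine ⟨0, aeBounded_dirac 0, inferInstance, by simp, by simp, by simp, fun f g _ => by simp⟩

lemma HasZeroBias.mono {μ : Measure ℝ} {m v δ δ' : ℝ} (h : HasZeroBias μ m v δ) (hδ : δ ≤ δ') :
    HasZeroBias μ m v δ' :=
  h.imp fun _ hν => { hν with close := hν.close.mono fun _ hp => hp.trans hδ }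

/-- Only one summand is altered at a time, so the distance stays `δ` rather than doubling. Keeping
the mass of `ν` equal to the variance turns the random choice of that summand into a sum of
measures. -/
lemma HasZeroBias.conv {μ₁ μ₂ : Measure ℝ} [IsProbabilityMeasure μ₁] [IsProbabilityMeasure μ₂]
    {m₁ m₂ v₁ v₂ δ : ℝ} (h₁ : HasZeroBias μ₁ m₁ v₁ δ) (h₂ : HasZeroBias μ₂ m₂ v₂ δ) :
    HasZeroBias (μ₁ ∗ μ₂) (m₁ + m₂) (v₁ + v₂) δ := by
  obtain ⟨ν₁, h₁⟩ := h₁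
  obtain ⟨ν₂, h₂⟩ := h₂
  have := h₁.finite
  have := h₂.finite
  have hT₁ : Measurable fun q : (ℝ × ℝ) × ℝ => (q.1.1 + q.2, q.1.2 + q.2) := by fun_prop
  have hT₂ : Measurable fun q : ℝ × (ℝ × ℝ) => (q.1 + q.2.1, q.1 + q.2.2) := by fun_prop
  refine ⟨(ν₁.prod μ₂).map (fun q => (q.1.1 + q.2, q.1.2 + q.2)) +
    (μ₁.prod ν₂).map (fun q => (q.1 + q.2.1, q.1 + q.2.2)), h₁.bdd.conv h₂.bdd, inferInstance,
    ?_, ?_, ?_, ?_⟩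
  · rw [measureReal_add_apply, map_measureReal_apply hT₁ .univ, map_measureReal_apply hT₂ .univ,
      Set.preimage_univ, Set.preimage_univ, measureReal_def, measureReal_def, prod_measure_univ,
      prod_measure_univ, ENNReal.toReal_mul, ENNReal.toReal_mul]
    simp only [← measureReal_def, h₁.mass, h₂.mass, probReal_univ, mul_one, one_mul]
  · have e₁ : ((ν₁.prod μ₂).map (fun q => (q.1.1 + q.2, q.1.2 + q.2))).map Prod.fst
        = ν₁ Set.univ • (μ₁ ∗ μ₂) := by
      rw [Measure.map_map measurable_fst hT₁, ← Measure.conv_smul_left, ← h₁.map_fst, Measure.conv,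
        ← Measure.map_id (μ := μ₂), Measure.map_prod_map _ _ measurable_fst measurable_id,
        Measure.map_map (by fun_prop) (by fun_prop), Measure.map_id]
      rfl
    have e₂ : ((μ₁.prod ν₂).map (fun q => (q.1 + q.2.1, q.1 + q.2.2))).map Prod.fst
        = ν₂ Set.univ • (μ₁ ∗ μ₂) := by
      rw [Measure.map_map measurable_fst hT₂, ← Measure.conv_smul_right, ← h₂.map_fst, Measure.conv,
        ← Measure.map_id (μ := μ₁), Measure.map_prod_map _ _ measurable_id measurable_fst,
        Measure.map_map (by fun_prop) (by fun_prop), Measure.map_id]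
      rfl
    rw [Measure.map_add _ _ measurable_fst, e₁, e₂, ← add_smul, Measure.add_apply,
      Measure.map_apply hT₁ .univ, Measure.map_apply hT₂ .univ]
    simp [prod_measure_univ]
  · have hm : MeasurableSet {p : ℝ × ℝ | |p.1 - p.2| ≤ δ} :=
      measurableSet_le (by fun_prop) (by fun_prop)
    rw [ae_add_measure_iff, ae_map_iff hT₁.aemeasurable hm, ae_map_iff hT₂.aemeasurable hm]
    refine ⟨?_, ?_⟩
    · filter_upwards [Measure.quasiMeasurePreserving_fst.ae h₁.close] with q hq
      simpa using hq
    · filter_upwards [Measure.quasiMeasurePreserving_snd.ae h₂.close] with q hq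
      simpa using hq
  · intro f g hfg
    have hf := MeasLocBdd.of_continuous hfg.continuous
    have hg := hfg.measLocBdd_deriv
    obtain ⟨M, hM⟩ := hfg.bdd
    have lin (m : ℝ) : MeasLocBdd fun x => x - m := .of_continuous (by fun_prop)
    have hgi {α : Type} [MeasurableSpace α] {ρ : Measure α} [IsFiniteMeasure ρ] {X : α → ℝ}
        (hX : Measurable X) : Integrable (fun a => g (X a)) ρ :=
      Integrable.of_bound (hfg.meas.comp hX).aestronglyMeasurable M (ae_of_all _ fun a => hM _)
    have hi₁ : Integrable (fun q : ℝ × ℝ => (q.1 - m₁) * f (q.1 + q.2)) (μ₁.prod μ₂) :=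
      (lin m₁).integrable_mul hf measurable_fst (by fun_prop) (h₁.bdd.fst _)
        (h₁.bdd.add_prod h₂.bdd)
    have hi₂ : Integrable (fun q : ℝ × ℝ => (q.2 - m₂) * f (q.1 + q.2)) (μ₁.prod μ₂) :=
      (lin m₂).integrable_mul hf measurable_snd (by fun_prop) (h₂.bdd.snd _)
        (h₁.bdd.add_prod h₂.bdd)
    have e₁ : ∫ q, (q.1 - m₁) * f (q.1 + q.2) ∂(μ₁.prod μ₂)
        = ∫ q, g (q.1.2 + q.2) ∂(ν₁.prod μ₂) := by
      -- With the other summand frozen at `y`, the Stein identity applies to the translate of `f` by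
      -- `y`.
      rw [integral_prod_symm _ hi₁, integral_prod_symm _ (hgi (by fun_prop))]
      exact integral_congr_ae (ae_of_all _ fun y => h₁.stein _ _ (hfg.comp_add_right y))
    have e₂ : ∫ q, (q.2 - m₂) * f (q.1 + q.2) ∂(μ₁.prod μ₂)
        = ∫ q, g (q.1 + q.2.2) ∂(μ₁.prod ν₂) := by
      rw [integral_prod _ hi₂, integral_prod _ (hgi (by fun_prop))]
      refine integral_congr_ae (ae_of_all _ fun y => ?_)
      simp only [add_comm y]
      exact h₂.stein _ _ (hfg.comp_add_right y)
    have hgs {ρ : Measure (ℝ × ℝ)} : AEStronglyMeasurable (fun p => g p.2) ρ :=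
      (hfg.meas.comp measurable_snd).aestronglyMeasurable
    rw [integral_add_measure (hgi measurable_snd) (hgi measurable_snd),
      integral_map hT₁.aemeasurable hgs, integral_map hT₂.aemeasurable hgs,
      ← e₁, ← e₂, ← integral_add hi₁ hi₂, Measure.conv, integral_map (by fun_prop)
        ((lin _).mul hf).meas.aestronglyMeasurable]
    refine integral_congr_ae (ae_of_all _ fun q => ?_)
    simp only
    ring

/-- A law with mean `m` supported in `[m - a, m + a]` has a zero-bias transform at distance at
most `2 a`. -/
lemma hasZeroBias_of_abs_sub_le {μ : Measure ℝ} [IsProbabilityMeasure μ] {m a : ℝ}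
    (ha : ∀ᵐ x ∂μ, |x - m| ≤ a) (hm : ∫ x, x ∂μ = m) :
    HasZeroBias μ m (∫ x, (x - m) ^ 2 ∂μ) (2 * a) := by
  have hb : AEBounded μ := by
    refine ⟨a + |m|, ha.mono fun x hx => ?_⟩
    calc |x| = |(x - m) + m| := by ring_nf
      _ ≤ a + |m| := (abs_add_le _ _).trans (by linarith)
  have hsq : MeasLocBdd fun x => (x - m) ^ 2 := .of_continuous (by fun_prop)
  have hsqi : Integrable (fun x => (x - m) ^ 2) μ := hsq.integrable measurable_id hb
  let d : ℝ → NNReal := fun x => Real.toNNReal ((x - m) ^ 2)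
  have hd : Measurable d := by fun_prop
  have hdc (x : ℝ) : ((d x : NNReal) : ℝ) = (x - m) ^ 2 := Real.coe_toNNReal _ (sq_nonneg _)
  let ρ : Measure ℝ := μ.withDensity fun x => (d x : ENNReal)
  have hρi (h : ℝ → ℝ) : ∫ x, h x ∂ρ = ∫ x, (x - m) ^ 2 * h x ∂μ := by
    rw [integral_withDensity_eq_integral_smul hd]
    refine integral_congr_ae (ae_of_all _ fun x => ?_)
    simp only [NNReal.smul_def, hdc, smul_eq_mul]
  have hρf : IsFiniteMeasure ρ := isFiniteMeasure_withDensity_ofReal hsqi.2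
  let lam : Measure ℝ := volume.restrict (Set.Ioc 0 1)
  have hlam : IsProbabilityMeasure lam := ⟨by simp [lam]⟩
  have hT : Measurable fun q : ℝ × ℝ => m + q.2 * (q.1 - m) := by fun_prop
  -- Up to its mass, the zero-bias law: draw `x` with weight `(x - m) ^ 2`, then a uniform point of
  -- the segment from `m` to `x`.
  let κ : Measure ℝ := (ρ.prod lam).map fun q => m + q.2 * (q.1 - m)
  have hρm : ρ.real Set.univ = ∫ x, (x - m) ^ 2 ∂μ := by
    have := hρi fun _ => 1
    simpa using this
  have hκm : κ.real Set.univ = ∫ x, (x - m) ^ 2 ∂μ := by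
    rw [map_measureReal_apply hT .univ, Set.preimage_univ, ← Set.univ_prod_univ,
      measureReal_prod_prod, hρm]
    simp
  have hκa : ∀ᵐ y ∂κ, |y - m| ≤ a := by
    rw [ae_map_iff hT.aemeasurable (measurableSet_le (by fun_prop) (by fun_prop))]
    have h1 : ∀ᵐ x ∂ρ, |x - m| ≤ a := (withDensity_absolutelyContinuous _ _).ae_le ha
    have h2 : ∀ᵐ s ∂lam, s ∈ Set.Ioc (0 : ℝ) 1 := ae_restrict_mem measurableSet_Ioc
    filter_upwards [Measure.quasiMeasurePreserving_fst.ae h1,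
      Measure.quasiMeasurePreserving_snd.ae h2] with q hq hs
    rw [add_sub_cancel_left, abs_mul, abs_of_pos hs.1]
    exact (mul_le_of_le_one_left (abs_nonneg _) hs.2).trans hq
  -- An independent coupling suffices: both coordinates lie within `a` of `m`.
  refine ⟨μ.prod κ, hb, inferInstance, ?_, ?_, ?_, ?_⟩
  · rw [← Set.univ_prod_univ, measureReal_prod_prod, hκm]
    simp
  · rw [Measure.map_fst_prod, ← Set.univ_prod_univ, Measure.prod_prod]
    simp
  · filter_upwards [Measure.quasiMeasurePreserving_fst.ae ha,
      Measure.quasiMeasurePreserving_snd.ae hκa] with p h1 h2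
    calc |p.1 - p.2| = |(p.1 - m) - (p.2 - m)| := by ring_nf
      _ ≤ |p.1 - m| + |p.2 - m| := abs_sub _ _
      _ ≤ 2 * a := by linarith
  · intro f g hfg
    obtain ⟨M, hM⟩ := hfg.bdd
    have hf := MeasLocBdd.of_continuous hfg.continuous
    have lin : MeasLocBdd fun x => x - m := .of_continuous (by fun_prop)
    have hgi : Integrable (fun q : ℝ × ℝ => g (m + q.2 * (q.1 - m))) (ρ.prod lam) :=
      Integrable.of_bound (hfg.meas.comp hT).aestronglyMeasurable M (ae_of_all _ fun a => hM _)
    rw [integral_fun_snd, integral_map hT.aemeasurable hfg.meas.aestronglyMeasurable,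
      integral_prod _ hgi, hρi]
    -- Centering allows `f x` to be replaced by `f x - f m`, which is then `x - m` times the average
    -- of `g` over the segment from `m` to `x`.
    have h0 : ∫ x, (x - m) * f m ∂μ = 0 := by
      have hid : Integrable (fun x => x) μ :=
        (MeasLocBdd.of_continuous continuous_id).integrable measurable_id hb
      rw [integral_mul_const, integral_sub hid (integrable_const _), hm]
      simp
    have hi0 : Integrable (fun x => (x - m) * f m) μ :=
      (lin.mul (.of_continuous (continuous_const (y := f m)))).integrable measurable_id hb
    have hi1 : Integrable (fun x => (x - m) * f x) μ := (lin.mul hf).integrable measurable_id hb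
    rw [← sub_zero (∫ x, (x - m) * f x ∂μ), ← h0, ← integral_sub hi1 hi0]
    simp only [probReal_univ, one_smul]
    refine integral_congr_ae (ae_of_all _ fun x => ?_)
    simp only
    rw [← mul_sub, hfg.sub_eq, ← intervalIntegral.integral_of_le zero_le_one]
    have := intervalIntegral.smul_integral_comp_add_mul (a := 0) (b := 1) g (x - m) m
    simp only [mul_zero, add_zero, mul_one, add_sub_cancel, smul_eq_mul] at this
    rw [← this, sq, mul_assoc]
    simp only [mul_comm]

/-! ### The standard normal density, distribution function and tail -/

/-- The density of the standard normal distribution. -/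
noncomputable def stdNormalPDF (x : ℝ) : ℝ := gaussianPDFReal 0 1 x

lemma stdNormalPDF_eq (x : ℝ) : stdNormalPDF x = (√(2 * Real.pi))⁻¹ * Real.exp (-x ^ 2 / 2) := by
  simp [stdNormalPDF, gaussianPDFReal]

lemma stdNormalPDF_pos (x : ℝ) : 0 < stdNormalPDF x := gaussianPDFReal_pos _ _ _ one_ne_zero

lemma stdNormalPDF_neg (x : ℝ) : stdNormalPDF (-x) = stdNormalPDF x := by
  simp [stdNormalPDF_eq]

lemma integrable_stdNormalPDF : Integrable stdNormalPDF := integrable_gaussianPDFReal 0 1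

lemma hasDerivAt_stdNormalPDF (x : ℝ) : HasDerivAt stdNormalPDF (-x * stdNormalPDF x) x := by
  have h : HasDerivAt (fun x : ℝ => (√(2 * Real.pi))⁻¹ * Real.exp (-x ^ 2 / 2))
      ((√(2 * Real.pi))⁻¹ * (Real.exp (-x ^ 2 / 2) * (-(2 * x) / 2))) x := by
    refine (HasDerivAt.exp ?_).const_mul _
    have := ((hasDerivAt_pow 2 x).neg.div_const 2)
    simpa using this
  rw [show stdNormalPDF = _ from funext stdNormalPDF_eq]
  convert h using 1
  ring

lemma continuous_stdNormalPDF : Continuous stdNormalPDF :=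
  continuous_iff_continuousAt.mpr fun x => (hasDerivAt_stdNormalPDF x).continuousAt

lemma two_lt_sqrt_two_pi : 2 < √(2 * Real.pi) := by
  rw [Real.lt_sqrt (by norm_num)]
  linarith [Real.pi_gt_three]

lemma sqrt_two_pi_lt_three : √(2 * Real.pi) < 3 := by
  rw [Real.sqrt_lt' (by norm_num)]
  linarith [Real.pi_lt_four]

lemma stdNormalPDF_le_one (x : ℝ) : stdNormalPDF x ≤ 1 := by
  rw [stdNormalPDF_eq]
  refine mul_le_one₀ (inv_le_one_of_one_le₀ (by linarith [two_lt_sqrt_two_pi]))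
    (Real.exp_pos _).le (Real.exp_le_one_iff.mpr ?_)
  have := sq_nonneg x
  linarith

lemma tendsto_stdNormalPDF_atTop : Tendsto stdNormalPDF atTop (𝓝 0) := by
  rw [show stdNormalPDF = _ from funext stdNormalPDF_eq, ← mul_zero (√(2 * Real.pi))⁻¹]
  refine (Real.tendsto_exp_atBot.comp ?_).const_mul _
  have h : Tendsto (fun x : ℝ => x ^ 2 / 2) atTop atTop :=
    (tendsto_pow_atTop two_ne_zero).atTop_div_const two_pos
  refine (tendsto_neg_atTop_atBot.comp h).congr fun x => ?_
  simp [neg_div]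

lemma stdNormalCDF_eq_integral (x : ℝ) : stdNormalCDF x = ∫ t in Iic x, stdNormalPDF t := by
  rw [stdNormalCDF, cdf_eq_real, measureReal_def,
    gaussianReal_apply_eq_integral 0 one_ne_zero, ENNReal.toReal_ofReal]
  · rfl
  · exact setIntegral_nonneg measurableSet_Iic fun t _ => (stdNormalPDF_pos t).le

lemma integral_stdNormalPDF : ∫ t, stdNormalPDF t = 1 :=
  integral_gaussianPDFReal_eq_one 0 one_ne_zero

lemma one_sub_stdNormalCDF (x : ℝ) : 1 - stdNormalCDF x = ∫ t in Ioi x, stdNormalPDF t := by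
  rw [stdNormalCDF_eq_integral, ← integral_stdNormalPDF, sub_eq_iff_eq_add, ← compl_Iic, add_comm,
    integral_add_compl measurableSet_Iic integrable_stdNormalPDF]

lemma stdNormalCDF_neg (x : ℝ) : stdNormalCDF (-x) = 1 - stdNormalCDF x := by
  rw [one_sub_stdNormalCDF, stdNormalCDF_eq_integral, ← integral_comp_neg_Ioi]
  simp only [stdNormalPDF_neg]

lemma stdNormalCDF_sub (a b : ℝ) :
    stdNormalCDF b - stdNormalCDF a = ∫ t in a..b, stdNormalPDF t := by
  rw [stdNormalCDF_eq_integral, stdNormalCDF_eq_integral]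
  exact intervalIntegral.integral_Iic_sub_Iic integrable_stdNormalPDF.integrableOn
    integrable_stdNormalPDF.integrableOn

lemma hasDerivAt_stdNormalCDF (x : ℝ) : HasDerivAt stdNormalCDF (stdNormalPDF x) x := by
  have h := (intervalIntegral.integral_hasDerivAt_right
    (continuous_stdNormalPDF.intervalIntegrable 0 x)
    (continuous_stdNormalPDF.stronglyMeasurableAtFilter _ _)
    continuous_stdNormalPDF.continuousAt).add_const (stdNormalCDF 0)
  refine h.congr_of_eventuallyEq (Eventually.of_forall fun u => ?_)
  simp only [← stdNormalCDF_sub, sub_add_cancel]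

lemma stdNormalCDF_nonneg (x : ℝ) : 0 ≤ stdNormalCDF x := cdf_nonneg _ _

lemma stdNormalCDF_le_one (x : ℝ) : stdNormalCDF x ≤ 1 := cdf_le_one _ _

lemma monotone_stdNormalCDF : Monotone stdNormalCDF := monotone_cdf _

lemma stdNormalCDF_le_add {a b : ℝ} (h : a ≤ b) : stdNormalCDF b ≤ stdNormalCDF a + (b - a) := by
  have h1 : |∫ t in a..b, stdNormalPDF t| ≤ 1 * |b - a| :=
    intervalIntegral.norm_integral_le_of_norm_le_const (f := stdNormalPDF) fun x _ => by
      rw [Real.norm_of_nonneg (stdNormalPDF_pos x).le]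
      exact stdNormalPDF_le_one x
  rw [← stdNormalCDF_sub, one_mul, abs_of_nonneg (sub_nonneg.mpr h)] at h1
  linarith [le_abs_self (stdNormalCDF b - stdNormalCDF a)]

/-- The Mills ratio bound. -/
lemma mul_one_sub_stdNormalCDF_le {x : ℝ} (hx : 0 ≤ x) :
    x * (1 - stdNormalCDF x) ≤ stdNormalPDF x := by
  have hd (t : ℝ) : HasDerivAt (fun t => -stdNormalPDF t) (t * stdNormalPDF t) t := by
    exact (hasDerivAt_stdNormalPDF t).neg.congr_deriv (by ring)
  have hpos : ∀ t ∈ Ioi x, 0 ≤ t * stdNormalPDF t := fun t ht =>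
    mul_nonneg (hx.trans (le_of_lt ht)) (stdNormalPDF_pos t).le
  have hlim : Tendsto (fun t => -stdNormalPDF t) atTop (𝓝 0) := by
    simpa using tendsto_stdNormalPDF_atTop.neg
  have hi := integrableOn_Ioi_deriv_of_nonneg' (fun t _ => hd t) hpos hlim
  have he := integral_Ioi_of_hasDerivAt_of_nonneg' (fun t _ => hd t) hpos hlim
  rw [one_sub_stdNormalCDF, ← integral_const_mul]
  calc ∫ t in Ioi x, x * stdNormalPDF t ≤ ∫ t in Ioi x, t * stdNormalPDF t :=
        setIntegral_mono_on (integrable_stdNormalPDF.integrableOn.const_mul x) hi measurableSet_Ioi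
          fun t ht => mul_le_mul_of_nonneg_right (le_of_lt ht) (stdNormalPDF_pos t).le
    _ = stdNormalPDF x := by rw [he]; ring

lemma one_sub_stdNormalCDF_le {x : ℝ} (hx : 0 ≤ x) :
    1 - stdNormalCDF x ≤ 6 * stdNormalPDF x := by
  rcases le_total 1 x with h | h
  · have := mul_one_sub_stdNormalCDF_le hx
    nlinarith [stdNormalCDF_le_one x, stdNormalPDF_pos x]
  -- On `[0, 1]` the tail is at most `1` and the density at least `1 / 6`, which is where the
  -- constant `6` comes from.
  · have h1 : (1 : ℝ) / 2 ≤ Real.exp (-x ^ 2 / 2) := by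
      have := Real.add_one_le_exp (-x ^ 2 / 2)
      nlinarith
    have h2 : (1 : ℝ) / 3 ≤ (√(2 * Real.pi))⁻¹ := by
      rw [one_div]
      exact inv_anti₀ (by positivity) sqrt_two_pi_lt_three.le
    have h3 : (1 : ℝ) / 6 ≤ stdNormalPDF x := by
      rw [stdNormalPDF_eq]
      nlinarith
    linarith [stdNormalCDF_nonneg x]

/-! ### Stein's equation -/

/-- The bounded solution of Stein's equation for the indicator function of `(-∞, z]`. -/
noncomputable def steinSolution (z w : ℝ) : ℝ :=
  stdNormalCDF (min w z) * (1 - stdNormalCDF (max w z)) / stdNormalPDF w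

/-- The derivative of `steinSolution z` away from `z`, as given by Stein's equation. -/
noncomputable def steinDeriv (z w : ℝ) : ℝ :=
  w * steinSolution z w + (if w ≤ z then 1 else 0) - stdNormalCDF z

lemma steinSolution_nonneg (z w : ℝ) : 0 ≤ steinSolution z w :=
  div_nonneg (mul_nonneg (stdNormalCDF_nonneg _) (sub_nonneg.mpr (stdNormalCDF_le_one _)))
    (stdNormalPDF_pos w).le

/-- Useful for `w ≤ 0`, where the lower tail is controlled by the density; `steinSolution_le_right`
is its mirror image for `0 ≤ w`. -/
lemma steinSolution_le_left (z w : ℝ) :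
    steinSolution z w ≤ stdNormalCDF w / stdNormalPDF w := by
  refine div_le_div_of_nonneg_right ?_ (stdNormalPDF_pos w).le
  have h1 := monotone_stdNormalCDF (min_le_left w z)
  have h2 := stdNormalCDF_nonneg (max w z)
  have h3 := stdNormalCDF_nonneg (min w z)
  have h4 := stdNormalCDF_le_one (max w z)
  nlinarith

lemma steinSolution_le_right (z w : ℝ) :
    steinSolution z w ≤ (1 - stdNormalCDF w) / stdNormalPDF w := by
  refine div_le_div_of_nonneg_right ?_ (stdNormalPDF_pos w).le
  have h1 := monotone_stdNormalCDF (le_max_left w z)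
  have h2 := stdNormalCDF_le_one (min w z)
  have h3 := stdNormalCDF_nonneg (min w z)
  have h4 := stdNormalCDF_le_one (max w z)
  nlinarith

lemma steinSolution_le (z w : ℝ) : steinSolution z w ≤ 6 := by
  rcases le_total 0 w with h | h
  · refine (steinSolution_le_right z w).trans ?_
    rw [div_le_iff₀ (stdNormalPDF_pos w)]
    exact one_sub_stdNormalCDF_le h
  · refine (steinSolution_le_left z w).trans ?_
    rw [div_le_iff₀ (stdNormalPDF_pos w), ← stdNormalPDF_neg]
    have := one_sub_stdNormalCDF_le (neg_nonneg.mpr h)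
    rwa [stdNormalCDF_neg, sub_sub_cancel] at this

lemma abs_steinSolution_le (z w : ℝ) : |steinSolution z w| ≤ 6 := by
  rw [abs_of_nonneg (steinSolution_nonneg z w)]
  exact steinSolution_le z w

lemma abs_mul_steinSolution_le (z w : ℝ) : |w * steinSolution z w| ≤ 1 := by
  rw [abs_mul, abs_of_nonneg (steinSolution_nonneg z w)]
  rcases le_total 0 w with h | h
  · rw [abs_of_nonneg h]
    refine (mul_le_mul_of_nonneg_left (steinSolution_le_right z w) h).trans ?_
    rw [← mul_div_assoc, div_le_one (stdNormalPDF_pos w)]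
    exact mul_one_sub_stdNormalCDF_le h
  · rw [abs_of_nonpos h]
    refine (mul_le_mul_of_nonneg_left (steinSolution_le_left z w) (neg_nonneg.mpr h)).trans ?_
    rw [← mul_div_assoc, div_le_one (stdNormalPDF_pos w), ← stdNormalPDF_neg]
    have := mul_one_sub_stdNormalCDF_le (neg_nonneg.mpr h)
    rwa [stdNormalCDF_neg, sub_sub_cancel] at this

lemma abs_steinDeriv_le (z w : ℝ) : |steinDeriv z w| ≤ 2 := by
  have h1 := abs_le.mp (abs_mul_steinSolution_le z w)
  have h2 := stdNormalCDF_nonneg z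
  have h3 := stdNormalCDF_le_one z
  rw [steinDeriv, abs_le]
  split_ifs <;> constructor <;> linarith

lemma continuous_stdNormalCDF : Continuous stdNormalCDF :=
  continuous_iff_continuousAt.mpr fun x => (hasDerivAt_stdNormalCDF x).continuousAt

lemma continuous_steinSolution (z : ℝ) : Continuous (steinSolution z) := by
  have := continuous_stdNormalCDF
  have := continuous_stdNormalPDF
  unfold steinSolution
  exact Continuous.div (by fun_prop) (by fun_prop) fun w => (stdNormalPDF_pos w).ne'

lemma hasDerivAt_steinSolution {z w : ℝ} (h : w ≠ z) :
    HasDerivAt (steinSolution z) (steinDeriv z w) w := by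
  have hp := (stdNormalPDF_pos w).ne'
  rcases h.lt_or_gt with h | h
  · have h1 := ((hasDerivAt_stdNormalCDF w).mul_const (1 - stdNormalCDF z)).div
      (hasDerivAt_stdNormalPDF w) hp
    refine (h1.congr_of_eventuallyEq ?_).congr_deriv ?_
    · filter_upwards [Iio_mem_nhds h] with u hu
      rw [steinSolution, min_eq_left (le_of_lt hu), max_eq_right (le_of_lt hu)]
      rfl
    · rw [steinDeriv, steinSolution, min_eq_left h.le, max_eq_right h.le, if_pos h.le]
      field_simp
      ring
  · have h1 := (((hasDerivAt_stdNormalCDF w).const_sub 1).const_mul (stdNormalCDF z)).div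
      (hasDerivAt_stdNormalPDF w) hp
    refine (h1.congr_of_eventuallyEq ?_).congr_deriv ?_
    · filter_upwards [Ioi_mem_nhds h] with u hu
      rw [steinSolution, min_eq_right (le_of_lt hu), max_eq_left (le_of_lt hu)]
      rfl
    · rw [steinDeriv, steinSolution, min_eq_right h.le, max_eq_left h.le, if_neg h.not_ge]
      field_simp
      ring

lemma measurable_steinDeriv (z : ℝ) : Measurable (steinDeriv z) := by
  have := (continuous_steinSolution z).measurable
  unfold steinDeriv
  exact ((measurable_id.mul this).add
    (Measurable.ite measurableSet_Iic measurable_const measurable_const)).sub measurable_const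

/-- The derivative jumps at `z`, but the solution is continuous there, so the fundamental theorem of
calculus survives this one exceptional point. -/
lemma isBddDeriv_steinSolution (z : ℝ) : IsBddDeriv (steinSolution z) (steinDeriv z) where
  meas := measurable_steinDeriv z
  bdd := ⟨2, abs_steinDeriv_le z⟩
  sub_eq a b := by
    refine (integral_eq_of_hasDerivAt_off_countable _ _ (countable_singleton z)
      (continuous_steinSolution z).continuousOn (fun x hx => hasDerivAt_steinSolution hx.2)
      ?_).symm
    rw [intervalIntegrable_iff]
    exact Measure.integrableOn_of_bounded (by simp) (measurable_steinDeriv z).aestronglyMeasurable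
      (M := 2) (ae_of_all _ (abs_steinDeriv_le z))

lemma abs_mul_steinSolution_sub_le (z a b : ℝ) :
    |a * steinSolution z a - b * steinSolution z b| ≤ (2 * |a| + 6) * |a - b| := by
  have h := (isBddDeriv_steinSolution z).abs_sub_le (abs_steinDeriv_le z) b a
  calc |a * steinSolution z a - b * steinSolution z b|
      = |a * (steinSolution z a - steinSolution z b) + (a - b) * steinSolution z b| := by ring_nf
    _ ≤ |a| * (2 * |a - b|) + |a - b| * 6 := by
      refine (abs_add_le _ _).trans ?_
      rw [abs_mul, abs_mul]
      gcongr
      exact abs_steinSolution_le z b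
    _ = _ := by ring

/-! ### The Berry–Esseen bound for zero-bias couplings -/

namespace IsZeroBiasCoupling

variable {μ : Measure ℝ} {ν : Measure (ℝ × ℝ)} {m v δ : ℝ}

lemma integral_fst (h : IsZeroBiasCoupling μ ν m v δ) {φ : ℝ → ℝ} (hφ : Measurable φ) :
    ∫ p, φ p.1 ∂ν = v * ∫ x, φ x ∂μ := by
  rw [← integral_map (φ := Prod.fst) measurable_fst.aemeasurable hφ.aestronglyMeasurable,
    h.map_fst, integral_smul_measure, ← measureReal_def, h.mass, smul_eq_mul]

lemma aeBounded_fst (h : IsZeroBiasCoupling μ ν m v δ) : ∃ R : ℝ, ∀ᵐ p ∂ν, |p.1| ≤ R := by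
  obtain ⟨R, hR⟩ := h.bdd
  refine ⟨R, ?_⟩
  rw [← ae_map_iff (f := Prod.fst) (p := fun x : ℝ => |x| ≤ R) measurable_fst.aemeasurable
    (measurableSet_le (by fun_prop) (by fun_prop)), h.map_fst]
  exact Measure.ae_smul_measure hR _

lemma integral_sq (h : IsZeroBiasCoupling μ ν m v δ) : ∫ x, (x - m) ^ 2 ∂μ = v := by
  have := h.stein (fun x => x - m) (fun _ => 1) ⟨measurable_const, ⟨1, by simp⟩, by simp⟩
  simpa [h.mass, ← sq] using this

lemma measureReal_fst_le (h : IsZeroBiasCoupling μ ν m v δ) (t : ℝ) :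
    ν.real {p | p.1 ≤ t} = v * μ.real (Iic t) := by
  have := congrArg (fun ρ => Measure.real ρ (Iic t)) h.map_fst
  rw [map_measureReal_apply measurable_fst measurableSet_Iic, measureReal_ennreal_smul_apply,
    ← measureReal_def, h.mass] at this
  exact this

/-- The normal approximation of the zero-bias transform. -/
lemma abs_measureReal_snd_le_sub_le (h : IsZeroBiasCoupling μ ν m v δ) {s : ℝ}
    (hs : 0 < s) (hv : v ≤ s ^ 2) (z : ℝ) :
    |ν.real {p | p.2 ≤ m + s * z} - v * stdNormalCDF z|
      ≤ v * (8 * (δ / s) + 2 * ((s ^ 2 - v) / s ^ 2)) := by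
  have := h.finite
  have hv0 : 0 ≤ v := h.mass ▸ measureReal_nonneg
  set f := steinSolution z
  set g := steinDeriv z
  have hfg : IsBddDeriv f g := isBddDeriv_steinSolution z
  have hs0 := hs.ne'
  let W : ℝ → ℝ := fun x => (x - m) / s
  have hW : Measurable W := by fun_prop
  have hWf : Measurable fun x => W x * f (W x) := hW.mul (hfg.continuous.measurable.comp hW)
  have hWfi {X : ℝ × ℝ → ℝ} (hX : Measurable X) : Integrable (fun p => W (X p) * f (W (X p))) ν :=
    Integrable.of_bound (hWf.comp hX).aestronglyMeasurable 1
      (ae_of_all _ fun p => abs_mul_steinSolution_le z _)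
  have hgi : Integrable (fun p : ℝ × ℝ => g (W p.2)) ν :=
    Integrable.of_bound (hfg.meas.comp (hW.comp measurable_snd)).aestronglyMeasurable 2
      (ae_of_all _ fun p => abs_steinDeriv_le z _)
  -- The Stein identity for the rescaled `f`: one factor `1 / s` comes from the chain rule, the
  -- other from `W`.
  have e1 : ∫ p, W p.1 * f (W p.1) ∂ν = v / s ^ 2 * ∫ p, g (W p.2) ∂ν := by
    have h1 := h.stein _ _ (hfg.comp_div hs0 m)
    rw [integral_div] at h1
    have h2 : ∫ x, W x * f (W x) ∂μ = (∫ x, (x - m) * f ((x - m) / s) ∂μ) / s := by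
      rw [← integral_div]
      refine integral_congr_ae (ae_of_all _ fun x => ?_)
      simp only [W]
      ring
    rw [h.integral_fst hWf, h2, h1]
    field_simp
    rfl
  -- Stein's equation, evaluated at the zero-biased coordinate.
  have e2 : ∫ p, g (W p.2) ∂ν = ∫ p, W p.2 * f (W p.2) ∂ν
      + (ν.real {p | p.2 ≤ m + s * z} - v * stdNormalCDF z) := by
    have hset : {p : ℝ × ℝ | W p.2 ≤ z} = {p | p.2 ≤ m + s * z} := by
      ext p
      simp only [W, mem_ofPred_eq, div_le_iff₀ hs, sub_le_iff_le_add]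
      rw [mul_comm z, add_comm]
    have hm : MeasurableSet {p : ℝ × ℝ | p.2 ≤ m + s * z} :=
      measurableSet_le (by fun_prop) (by fun_prop)
    have h3 : ∀ p : ℝ × ℝ, g (W p.2) = W p.2 * f (W p.2)
        + ({p : ℝ × ℝ | p.2 ≤ m + s * z}.indicator 1 p - stdNormalCDF z) := by
      intro p
      simp only [← hset, g, f, steinDeriv, indicator, mem_ofPred_eq, Pi.one_apply]
      ring
    have hi1 : Integrable ({p : ℝ × ℝ | p.2 ≤ m + s * z}.indicator (1 : ℝ × ℝ → ℝ)) ν :=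
      (integrable_const (1 : ℝ)).indicator hm
    have hi2 : Integrable (fun p =>
        {p : ℝ × ℝ | p.2 ≤ m + s * z}.indicator (1 : ℝ × ℝ → ℝ) p - stdNormalCDF z) ν :=
      hi1.sub (integrable_const _)
    simp_rw [h3]
    rw [integral_add (hWfi measurable_snd) hi2, integral_sub hi1 (integrable_const _), integral_indicator_one hm, integral_const, h.mass,
      smul_eq_mul]
  have e3 : ν.real {p | p.2 ≤ m + s * z} - v * stdNormalCDF z
      = (s ^ 2 - v) / s ^ 2 * ∫ p, g (W p.2) ∂ν
        + ∫ p, (W p.1 * f (W p.1) - W p.2 * f (W p.2)) ∂ν := by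
    rw [integral_sub (hWfi measurable_fst) (hWfi measurable_snd), e1, sub_div,
      div_self (by positivity)]
    linarith
  have b1 : |∫ p, g (W p.2) ∂ν| ≤ 2 * v := by
    rw [← h.mass, ← Real.norm_eq_abs]
    exact norm_integral_le_of_norm_le_const (ae_of_all _ fun p => abs_steinDeriv_le z _)
  have hsq : MeasLocBdd fun x => (W x) ^ 2 := .of_continuous (by fun_prop)
  have hsqi : Integrable (fun p : ℝ × ℝ => (W p.1) ^ 2) ν :=
    hsq.integrable measurable_fst h.aeBounded_fst
  have hsqv : ∫ p, (W p.1) ^ 2 ∂ν ≤ v := by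
    rw [h.integral_fst hsq.meas]
    simp only [W, div_pow]
    rw [integral_div, h.integral_sq]
    exact mul_le_of_le_one_right hv0 ((div_le_one (by positivity)).mpr hv)
  have hδv : 0 ≤ v * δ := by
    have : 0 ≤ ∫ _p, δ ∂ν :=
      integral_nonneg_of_ae (h.close.mono fun p hp => (abs_nonneg _).trans hp)
    simpa [h.mass] using this
  have b2 : |∫ p, (W p.1 * f (W p.1) - W p.2 * f (W p.2)) ∂ν| ≤ v * (8 * (δ / s)) := by
    have hbi : Integrable (fun p : ℝ × ℝ => (W p.1 ^ 2 + 7) * (δ / s)) ν :=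
      (hsqi.add (integrable_const _)).mul_const _
    calc |∫ p, (W p.1 * f (W p.1) - W p.2 * f (W p.2)) ∂ν|
        ≤ ∫ p, (W p.1 ^ 2 + 7) * (δ / s) ∂ν := by
          rw [← Real.norm_eq_abs]
          refine norm_integral_le_of_norm_le hbi (h.close.mono fun p hp => ?_)
          refine (abs_mul_steinSolution_sub_le z _ _).trans ?_
          have : |W p.1 - W p.2| ≤ δ / s := by
            rw [← sub_div, sub_sub_sub_cancel_right, abs_div, abs_of_pos hs]
            gcongr
          refine mul_le_mul ?_ this (abs_nonneg _) (by positivity)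
          -- Since `2 |W| ≤ W ^ 2 + 1`, a second moment at most `1` gives the constant `8 = 1 + 7`.
          nlinarith [sq_nonneg (|W p.1| - 1), sq_abs (W p.1)]
      _ = (∫ p, (W p.1) ^ 2 ∂ν + 7 * v) * (δ / s) := by
          rw [integral_mul_const, integral_add hsqi (integrable_const _), integral_const, h.mass,
            smul_eq_mul, mul_comm v]
      _ ≤ v * (8 * (δ / s)) := by
          -- When `v = 0` the sign of `δ` is unknown, but both sides vanish.
          rcases hv0.eq_or_lt with h0 | h0
          · have : ∫ p, (W p.1) ^ 2 ∂ν = 0 :=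
              le_antisymm (h0 ▸ hsqv) (integral_nonneg fun p => sq_nonneg _)
            rw [this, ← h0]
            simp
          · have : 0 ≤ δ / s := div_nonneg (nonneg_of_mul_nonneg_right hδv h0) hs.le
            nlinarith
  have hc : 0 ≤ (s ^ 2 - v) / s ^ 2 := div_nonneg (sub_nonneg.mpr hv) (by positivity)
  rw [e3]
  refine (abs_add_le _ _).trans ?_
  rw [abs_mul, abs_of_nonneg hc]
  nlinarith

end IsZeroBiasCoupling

/-- A Berry–Esseen bound for laws with a bounded zero-bias coupling. -/
theorem HasZeroBias.abs_measureReal_Iic_sub_le {μ : Measure ℝ} {m v δ : ℝ}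
    (h : HasZeroBias μ m v δ) (hδ : 0 ≤ δ) (hv : 0 < v) {s : ℝ} (hs : 0 < s) (hvs : v ≤ s ^ 2)
    (z : ℝ) :
    |μ.real (Iic (m + s * z)) - stdNormalCDF z| ≤ 9 * (δ / s) + 2 * ((s ^ 2 - v) / s ^ 2) := by
  obtain ⟨ν, h⟩ := h
  have := h.finite
  have hd : 0 ≤ δ / s := by positivity
  have hsd : s * (δ / s) = δ := mul_div_cancel₀ _ hs.ne'
  have h1 := (abs_le.mp (h.abs_measureReal_snd_le_sub_le hs hvs (z + δ / s))).2
  have h2 := (abs_le.mp (h.abs_measureReal_snd_le_sub_le hs hvs (z - δ / s))).1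
  -- The coordinates differ by at most `δ`, so `p.1` below a threshold forces `p.2` below the
  -- threshold raised by `δ`. The resulting shift of `z` by `δ / s` costs at most `δ / s` in `Φ`,
  -- turning the constant `8` into `9`.
  have c1 : v * μ.real (Iic (m + s * z)) ≤ ν.real {p | p.2 ≤ m + s * (z + δ / s)} := by
    rw [← h.measureReal_fst_le]
    refine ENNReal.toReal_mono (measure_ne_top _ _) (measure_mono_ae ?_)
    filter_upwards [h.close] with p hp hp1
    have hp1 : p.1 ≤ m + s * z := hp1
    show p.2 ≤ m + s * (z + δ / s)
    rw [mul_add, hsd]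
    linarith [(abs_le.mp hp).1]
  have c2 : ν.real {p | p.2 ≤ m + s * (z - δ / s)} ≤ v * μ.real (Iic (m + s * z)) := by
    rw [← h.measureReal_fst_le]
    refine ENNReal.toReal_mono (measure_ne_top _ _) (measure_mono_ae ?_)
    filter_upwards [h.close] with p hp hp1
    have hp1 : p.2 ≤ m + s * (z - δ / s) := hp1
    show p.1 ≤ m + s * z
    rw [mul_sub, hsd] at hp1
    linarith [(abs_le.mp hp).2]
  have d1 := stdNormalCDF_le_add (a := z) (b := z + δ / s) (by linarith)
  have d2 := stdNormalCDF_le_add (a := z - δ / s) (b := z) (by linarith)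
  rw [abs_le]
  constructor
  · refine le_of_mul_le_mul_left ?_ hv
    nlinarith
  · refine le_of_mul_le_mul_left ?_ hv
    nlinarith

/-! ### Insertion of the largest letter -/

/-- The permutation obtained from the word of `π` by inserting the new largest letter at
position `p`. -/
def insertMax {n : ℕ} (p : Fin (n + 1)) (π : Equiv.Perm (Fin n)) : Equiv.Perm (Fin (n + 1)) :=
  (finSuccEquiv' p).trans ((Equiv.optionCongr π).trans (finSuccEquiv' (Fin.last n)).symm)

section insertMax

variable {n : ℕ} (p : Fin (n + 1)) (π : Equiv.Perm (Fin n))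

@[simp]
lemma insertMax_self : insertMax p π p = Fin.last n := by
  simp [insertMax]

@[simp]
lemma insertMax_succAbove (i : Fin n) : insertMax p π (p.succAbove i) = (π i).castSucc := by
  simp [insertMax]

lemma bijective_insertMax :
    Function.Bijective fun q : Fin (n + 1) × Equiv.Perm (Fin n) => insertMax q.1 q.2 := by
  rw [Fintype.bijective_iff_injective_and_card]
  refine ⟨?_, by simp [Fintype.card_perm, Nat.factorial_succ]⟩
  rintro ⟨p, π⟩ ⟨q, σ⟩ h
  simp only at h
  have hpq : p = q := by
    apply (insertMax p π).injective
    rw [insertMax_self, h, insertMax_self]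
  subst hpq
  refine Prod.ext rfl (Equiv.ext fun i => ?_)
  have := congrArg (fun τ => τ (p.succAbove i)) h
  simpa using this

lemma sum_perm_succ {M : Type*} [AddCommMonoid M] (F : Equiv.Perm (Fin (n + 1)) → M) :
    ∑ σ, F σ = ∑ π : Equiv.Perm (Fin n), ∑ p, F (insertMax p π) := by
  rw [← Fintype.sum_prod_type_right' (f := fun p π => F (insertMax p π))]
  exact (bijective_insertMax.sum_comp F).symm

/-- The new letter is inverted with exactly the letters to its right. -/
lemma inversions_insertMax : inversions (insertMax p π) = inversions π + (p.rev : ℕ) := by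
  have hcard : ∑ j : Fin n, (if p < p.succAbove j then 1 else 0) = (p.rev : ℕ) := by
    have h1 : ∑ j : Fin (n + 1), (if p < j then 1 else 0) = (p.rev : ℕ) := by
      rw [← Finset.card_filter, Fin.val_rev]
      have : (Finset.univ.filter fun j => p < j) = Finset.Ioi p := by ext; simp
      rw [this, Fin.card_Ioi]
      omega
    rw [← h1, Fin.sum_univ_succAbove _ p]
    simp
  simp only [inversions, Finset.card_filter, Fintype.sum_prod_type]
  rw [Fin.sum_univ_succAbove _ p, Fin.sum_univ_succAbove _ p]
  simp only [Fin.sum_univ_succAbove _ p, insertMax_self, insertMax_succAbove,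
    Fin.castSucc_lt_last, (Fin.castSucc_lt_last _).not_gt, lt_irrefl, and_true, and_false, if_false,
    zero_add, Fin.succAbove_lt_succAbove_iff, Fin.castSucc_lt_castSucc_iff, hcard]
  rw [add_comm]

/-- The set of descent bottoms of a permutation. -/
def descentBottoms : Finset (Fin n) :=
  Finset.univ.filter fun j => ∃ i : Fin n, (i : ℕ) + 1 = (j : ℕ) ∧ π j < π i

lemma card_descentBottoms : (descentBottoms π).card = descents π := by
  refine (Finset.card_bij (fun q _ => q.2) ?_ ?_ ?_).symm
  · intro q hq
    simp only [Finset.mem_filter, Finset.mem_univ, true_and, descentBottoms] at hq ⊢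
    exact ⟨q.1, hq⟩
  · rintro ⟨a, b⟩ hq ⟨c, d⟩ hr h
    simp only [Finset.mem_filter, Finset.mem_univ, true_and] at hq hr h
    subst h
    have : a = c := Fin.ext (by omega)
    rw [this]
  · intro j hj
    simp only [Finset.mem_filter, Finset.mem_univ, true_and, descentBottoms] at hj
    obtain ⟨i, hi⟩ := hj
    exact ⟨(i, j), by simpa using hi, rfl⟩

/-- Old neighbours stay adjacent unless the new letter lands between them. -/
lemma succAbove_add_one_eq_iff (i j : Fin n) :
    ((p.succAbove i : Fin (n + 1)) : ℕ) + 1 = (p.succAbove j : Fin (n + 1)) ↔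
      (i : ℕ) + 1 = j ∧ (p : ℕ) ≠ j := by
  simp only [Fin.succAbove, Fin.lt_def, Fin.val_castSucc]
  split_ifs <;> simp <;> omega

lemma descents_insertMax_last : descents (insertMax (Fin.last n) π) = descents π := by
  simp only [descents, Finset.card_filter, Fintype.sum_prod_type]
  rw [Fin.sum_univ_succAbove _ (Fin.last n)]
  simp only [Fin.sum_univ_succAbove _ (Fin.last n), insertMax_self, insertMax_succAbove,
    (Fin.castSucc_lt_last _).not_gt, lt_irrefl, and_false, if_false, zero_add,
    succAbove_add_one_eq_iff, Fin.castSucc_lt_castSucc_iff, Fin.castSucc_lt_last, and_true]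
  rw [Finset.sum_eq_zero, zero_add]
  · refine Finset.sum_congr rfl fun i _ => Finset.sum_congr rfl fun j _ => ?_
    simp [j.isLt.ne']
  · intro j _
    rw [if_neg]
    simp
    omega

/-- The new letter forms a descent with old letter `k`, and destroys the descent ending at `k` if
there was one. -/
lemma descents_insertMax_castSucc (k : Fin n) :
    descents (insertMax k.castSucc π) = descents π + (if k ∈ descentBottoms π then 0 else 1) := by
  have hb : (if k ∈ descentBottoms π then 1 else 0)
      = ∑ i : Fin n, ∑ j : Fin n, if ((i : ℕ) + 1 = j ∧ π j < π i) ∧ k = j then 1 else 0 := by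
    have : ∀ i j : Fin n, (if ((i : ℕ) + 1 = j ∧ π j < π i) ∧ k = j then 1 else 0)
        = if k = j then (if (i : ℕ) + 1 = k ∧ π k < π i then 1 else 0) else 0 := by
      intro i j
      by_cases h : k = j
      · subst h; simp
      · simp [h]
    simp only [this, Finset.sum_ite_eq, Finset.mem_univ, if_true]
    by_cases h : k ∈ descentBottoms π
    · rw [if_pos h]
      simp only [Finset.mem_filter, Finset.mem_univ, true_and, descentBottoms] at h
      obtain ⟨i, hi⟩ := h
      rw [Finset.sum_eq_single i, if_pos hi]
      · intro c _ hc
        rw [if_neg]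
        rintro ⟨h1, _⟩
        exact hc (Fin.ext (by omega))
      · simp
    · rw [if_neg h, Finset.sum_eq_zero]
      intro i _
      rw [if_neg]
      intro hi
      exact h (by simpa [descentBottoms] using ⟨i, hi⟩)
  -- Stated additively to avoid truncated subtraction.
  have hmain : descents (insertMax k.castSucc π) + (if k ∈ descentBottoms π then 1 else 0)
      = descents π + 1 := by
    rw [hb]
    simp only [descents, Finset.card_filter, Fintype.sum_prod_type]
    rw [Fin.sum_univ_succAbove _ k.castSucc]
    simp only [Fin.sum_univ_succAbove _ k.castSucc, insertMax_self, insertMax_succAbove,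
      (Fin.castSucc_lt_last _).not_gt, lt_irrefl, and_false, if_false, zero_add,
      succAbove_add_one_eq_iff, Fin.castSucc_lt_castSucc_iff, Fin.castSucc_lt_last, and_true]
    rw [add_assoc, ← Finset.sum_add_distrib, add_comm]
    congr 1
    · refine Finset.sum_congr rfl fun i _ => ?_
      rw [← Finset.sum_add_distrib]
      refine Finset.sum_congr rfl fun j _ => ?_
      by_cases h : k = j
      · subst h; simp
      · have : (k : ℕ) ≠ j := fun h' => h (Fin.ext h')
        simp [h, this]
    · rw [Finset.sum_eq_single k]
      · simp [Fin.succAbove]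
      · intro j _ hj
        rw [if_neg]
        simp only [Fin.succAbove, Fin.lt_def, Fin.val_castSucc]
        have : (j : ℕ) ≠ k := fun h' => hj (Fin.ext h')
        split_ifs <;> simp <;> omega
      · simp
  split_ifs at hmain ⊢ <;> omega

/-- The Eulerian recurrence: the end of the word and the places just before the descent bottoms are
the insertions that preserve the count. -/
lemma sum_descents_insertMax (g : ℤ → ℝ) :
    ∑ p : Fin (n + 1), g (descents (insertMax p π))
      = ((descents π : ℝ) + 1) * g (descents π)
        + ((n : ℝ) - descents π) * g (descents π + 1) := by
  have h (k : Fin n) : g (descents (insertMax k.castSucc π))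
      = g (descents π + 1) + if k ∈ descentBottoms π then g (descents π) - g (descents π + 1)
        else 0 := by
    rw [descents_insertMax_castSucc]
    split_ifs <;> simp
  rw [Fin.sum_univ_castSucc, descents_insertMax_last]
  simp only [h, Finset.sum_add_distrib, Finset.sum_const, Finset.card_univ, Fintype.card_fin,
    Finset.sum_ite_mem, Finset.univ_inter, card_descentBottoms, nsmul_eq_mul]
  ring

end insertMax

/-! ### The law of the number of inversions -/

lemma integral_uniformOn_univ {α : Type*} [Fintype α] [Nonempty α] [MeasurableSpace α]
    [DiscreteMeasurableSpace α] (f : α → ℝ) :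
    ∫ a, f a ∂(uniformOn univ : Measure α) = (∑ a, f a) / Fintype.card α := by
  have h (a : α) : (uniformOn univ : Measure α).real {a} = (Fintype.card α : ℝ)⁻¹ := by
    rw [measureReal_def, uniformOn_univ]
    simp
  rw [integral_fintype Integrable.of_finite, Finset.sum_div]
  exact Finset.sum_congr rfl fun a _ => by rw [h, smul_eq_mul]; ring

instance discreteMeasurableSpace_perm (n : ℕ) : DiscreteMeasurableSpace (Equiv.Perm (Fin n)) :=
  ⟨fun _ => trivial⟩

lemma integral_uniformPerm_zero (f : Equiv.Perm (Fin 0) → ℝ) :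
    ∫ π, f π ∂(uniformPerm 0) = f 1 := by
  rw [uniformPerm, integral_uniformOn_univ]
  simp

lemma integral_uniformPerm_succ (n : ℕ) (f : Equiv.Perm (Fin (n + 1)) → ℝ) :
    ∫ σ, f σ ∂(uniformPerm (n + 1))
      = ∫ π, (∑ p, f (insertMax p π)) / (n + 1) ∂(uniformPerm n) := by
  rw [uniformPerm, uniformPerm, integral_uniformOn_univ, integral_uniformOn_univ, sum_perm_succ,
    ← Finset.sum_div, div_div]
  simp [Fintype.card_perm, Nat.factorial_succ]

/-- The uniform distribution on `{0, …, k}`. -/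
noncomputable def discreteUniform (k : ℕ) : Measure ℝ :=
  (uniformOn univ : Measure (Fin (k + 1))).map fun j : Fin (k + 1) => ((j : ℕ) : ℝ)

lemma measurable_finVal (k : ℕ) : Measurable fun j : Fin k => ((j : ℕ) : ℝ) :=
  measurable_of_countable _

instance isProbabilityMeasure_discreteUniform (k : ℕ) :
    IsProbabilityMeasure (discreteUniform k) := by
  have : IsProbabilityMeasure (uniformOn univ : Measure (Fin (k + 1))) :=
    isProbabilityMeasure_uniformOn finite_univ univ_nonempty
  exact Measure.isProbabilityMeasure_map (measurable_finVal _).aemeasurable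

lemma integral_discreteUniform (k : ℕ) {φ : ℝ → ℝ} (hφ : Measurable φ) :
    ∫ x, φ x ∂(discreteUniform k) = (∑ j : Fin (k + 1), φ (j : ℕ)) / (k + 1) := by
  rw [discreteUniform, integral_map (measurable_finVal _).aemeasurable hφ.aestronglyMeasurable,
    integral_uniformOn_univ]
  simp

lemma sum_range_cast (k : ℕ) : ∑ j ∈ Finset.range (k + 1), (j : ℝ) = (k : ℝ) * (k + 1) / 2 := by
  induction k with
  | zero => simp
  | succ k ih => rw [Finset.sum_range_succ, ih]; push_cast; ring

lemma sum_range_sub_sq (k : ℕ) (c : ℝ) : ∑ j ∈ Finset.range (k + 1), ((j : ℝ) - c) ^ 2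
    = (k : ℝ) * (k + 1) * (2 * k + 1) / 6 - c * (k * (k + 1)) + (k + 1) * c ^ 2 := by
  induction k with
  | zero => simp
  | succ k ih => rw [Finset.sum_range_succ, ih]; push_cast; ring

lemma abs_sub_half_le_ae_discreteUniform (k : ℕ) :
    ∀ᵐ x : ℝ ∂(discreteUniform k), |x - (k : ℝ) / 2| ≤ (k : ℝ) / 2 := by
  rw [discreteUniform, ae_map_iff (measurable_finVal _).aemeasurable
    (measurableSet_le (by fun_prop) (by fun_prop))]
  refine ae_of_all _ fun j => ?_
  have : ((j : ℕ) : ℝ) ≤ k := by exact_mod_cast Nat.lt_succ_iff.mp j.isLt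
  have : (0 : ℝ) ≤ (j : ℕ) := by positivity
  rw [abs_le]
  constructor <;> linarith

lemma hasZeroBias_discreteUniform (k : ℕ) :
    HasZeroBias (discreteUniform k) (k / 2) ((k : ℝ) * (k + 2) / 12) k := by
  have hk : (k : ℝ) + 1 ≠ 0 := by positivity
  have h := hasZeroBias_of_abs_sub_le (abs_sub_half_le_ae_discreteUniform k) (by
    rw [integral_discreteUniform k measurable_id', Fin.sum_univ_eq_sum_range (fun j => (j : ℝ)),
      sum_range_cast]
    field_simp)
  rw [integral_discreteUniform k (by fun_prop),
    Fin.sum_univ_eq_sum_range (fun j => ((j : ℝ) - k / 2) ^ 2), sum_range_sub_sq] at h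
  convert h using 1
  · field_simp
    ring
  · ring

/-- The law of a sum of independent variables, uniform on `{0}`, `{0, 1}`, …, `{0, …, n - 1}`. -/
noncomputable def inversionLaw : ℕ → Measure ℝ
  | 0 => Measure.dirac 0
  | n + 1 => inversionLaw n ∗ discreteUniform n

instance isProbabilityMeasure_inversionLaw : ∀ n, IsProbabilityMeasure (inversionLaw n)
  | 0 => inferInstanceAs (IsProbabilityMeasure (Measure.dirac (0 : ℝ)))
  | n + 1 =>
    have := isProbabilityMeasure_inversionLaw n
    inferInstanceAs (IsProbabilityMeasure (inversionLaw n ∗ discreteUniform n))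

/-- The coupling distance is governed by the largest summand, not by the range of the sum. -/
lemma hasZeroBias_inversionLaw (n : ℕ) :
    HasZeroBias (inversionLaw n) ((n : ℝ) * (n - 1) / 4)
      ((n : ℝ) * (n - 1) * (2 * n + 5) / 72) n := by
  induction n with
  | zero => simpa [inversionLaw] using hasZeroBias_dirac_zero 0
  | succ n ih =>
    have hn : (n : ℝ) ≤ ((n + 1 : ℕ) : ℝ) := by exact_mod_cast n.le_succ
    have h := (ih.mono hn).conv ((hasZeroBias_discreteUniform n).mono hn)
    rw [inversionLaw]
    convert h using 1 <;> push_cast <;> ring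

lemma integral_inversions (n : ℕ) {φ : ℝ → ℝ} (hφ : MeasLocBdd φ) :
    ∫ π, φ (inversions π) ∂(uniformPerm n) = ∫ x, φ x ∂(inversionLaw n) := by
  induction n generalizing φ with
  | zero =>
    rw [integral_uniformPerm_zero, inversionLaw, integral_dirac]
    simp [inversions]
  | succ n ih =>
    have hb : AEBounded (discreteUniform n) := (hasZeroBias_discreteUniform n).aeBounded
    have hshift (c : ℝ) : MeasLocBdd fun x => φ (x + c) := by
      refine ⟨hφ.meas.comp (measurable_add_const c), fun R => ?_⟩
      obtain ⟨M, hM⟩ := hφ.bdd (R + |c|)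
      exact ⟨M, fun x hx => hM _ ((abs_add_le _ _).trans (by linarith))⟩
    have hsum : MeasLocBdd fun x => (∑ j : Fin (n + 1), φ (x + (j : ℕ))) / ((n : ℝ) + 1) := by
      simp only [div_eq_mul_inv]
      refine MeasLocBdd.mul ?_ (.of_continuous continuous_const)
      have := Finset.sum_induction (s := Finset.univ)
        (fun (j : Fin (n + 1)) x => φ (x + (j : ℕ))) MeasLocBdd
        (fun _ _ h h' => h.add h') (.of_continuous continuous_const) (fun j _ => hshift _)
      convert this using 2
      rw [Finset.sum_apply]
    rw [integral_uniformPerm_succ, inversionLaw,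
      hφ.integral_conv (hasZeroBias_inversionLaw n).aeBounded hb]
    have h1 (x : ℝ) : ∫ y, φ (x + y) ∂(discreteUniform n)
        = (∑ j : Fin (n + 1), φ (x + (j : ℕ))) / ((n : ℝ) + 1) :=
      integral_discreteUniform n (hφ.meas.comp (measurable_const_add x))
    simp_rw [h1]
    rw [← ih hsum]
    refine integral_congr_ae (ae_of_all _ fun π => ?_)
    simp only [inversions_insertMax, Nat.cast_add]
    -- Summing over positions `p` or over inversion counts `p.rev` is the same.
    rw [← Equiv.sum_comp Fin.revPerm]
    simp

/-! ### The law of the number of descents -/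

/-- The uniform distribution on the unit interval. -/
noncomputable def unitUniform : Measure ℝ := volume.restrict (Ioc 0 1)

instance isProbabilityMeasure_unitUniform : IsProbabilityMeasure unitUniform :=
  ⟨by simp [unitUniform]⟩

lemma integral_unitUniform (φ : ℝ → ℝ) : ∫ u, φ u ∂unitUniform = ∫ u in (0 : ℝ)..1, φ u := by
  rw [unitUniform, intervalIntegral.integral_of_le zero_le_one]

lemma mem_Ioc_ae_unitUniform : ∀ᵐ u ∂unitUniform, u ∈ Ioc (0 : ℝ) 1 :=
  ae_restrict_mem measurableSet_Ioc

lemma hasZeroBias_unitUniform : HasZeroBias unitUniform (1 / 2) (1 / 12) 1 := by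
  have h : ∀ᵐ u ∂unitUniform, |u - 1 / 2| ≤ 1 / 2 := by
    filter_upwards [mem_Ioc_ae_unitUniform] with u hu
    rw [abs_le]
    constructor <;> linarith [hu.1, hu.2]
  have h2 := hasZeroBias_of_abs_sub_le h (by rw [integral_unitUniform]; simp)
  rw [integral_unitUniform, intervalIntegral.integral_comp_sub_right (fun x => x ^ 2)] at h2
  convert h2 using 1
  · rw [integral_pow]; norm_num
  · norm_num

/-- The law of a sum of `n` independent variables that are uniform on the unit interval. -/
noncomputable def irwinHall : ℕ → Measure ℝ
  | 0 => Measure.dirac 0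
  | n + 1 => irwinHall n ∗ unitUniform

instance isProbabilityMeasure_irwinHall : ∀ n, IsProbabilityMeasure (irwinHall n)
  | 0 => inferInstanceAs (IsProbabilityMeasure (Measure.dirac (0 : ℝ)))
  | n + 1 =>
    have := isProbabilityMeasure_irwinHall n
    inferInstanceAs (IsProbabilityMeasure (irwinHall n ∗ unitUniform))

lemma hasZeroBias_irwinHall (n : ℕ) :
    HasZeroBias (irwinHall n) ((n : ℝ) / 2) ((n : ℝ) / 12) 1 := by
  induction n with
  | zero => simpa [irwinHall] using hasZeroBias_dirac_zero 1
  | succ n ih =>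
    rw [irwinHall]
    convert ih.conv hasZeroBias_unitUniform using 1 <;> push_cast <;> ring

lemma MeasLocBdd.integral_irwinHall_succ {φ : ℝ → ℝ} (hφ : MeasLocBdd φ) (n : ℕ) :
    ∫ x, φ x ∂(irwinHall (n + 1)) = ∫ y, ∫ u, φ (y + u) ∂unitUniform ∂(irwinHall n) :=
  hφ.integral_conv (hasZeroBias_irwinHall n).aeBounded hasZeroBias_unitUniform.aeBounded

lemma MeasLocBdd.integrable_irwinHall {φ : ℝ → ℝ} (hφ : MeasLocBdd φ) (n : ℕ) :
    Integrable φ (irwinHall n) :=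
  hφ.integrable measurable_id (hasZeroBias_irwinHall n).aeBounded

lemma MeasLocBdd.average {φ ψ : ℝ → ℝ} (hφ : MeasLocBdd φ) (hψ : MeasLocBdd ψ) :
    MeasLocBdd fun y => ∫ u, ψ u * φ (y + u) ∂unitUniform where
  meas := by
    refine (StronglyMeasurable.integral_prod_right (f := fun y u => ψ u * φ (y + u)) ?_).measurable
    exact ((hψ.meas.comp measurable_snd).mul
      (hφ.meas.comp (measurable_fst.add measurable_snd))).stronglyMeasurable
  bdd R := by
    obtain ⟨M, hM⟩ := hφ.bdd (R + 1)
    obtain ⟨N, hN⟩ := hψ.bdd 1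
    refine ⟨N * M, fun y hy => ?_⟩
    have := norm_integral_le_of_norm_le_const (f := fun u => ψ u * φ (y + u)) (C := N * M)
      (μ := unitUniform) ?_
    · simpa using this
    · filter_upwards [mem_Ioc_ae_unitUniform] with u hu
      have hu1 : |u| ≤ 1 := by rw [abs_of_pos hu.1]; exact hu.2
      rw [norm_mul]
      exact mul_le_mul (hN u hu1) (hM _ ((abs_add_le _ _).trans (add_le_add hy hu1)))
        (norm_nonneg _) ((abs_nonneg _).trans (hN u hu1))

lemma measLocBdd_one : MeasLocBdd fun _ => 1 := .of_continuous continuous_const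

lemma measLocBdd_id : MeasLocBdd fun x => x := .of_continuous continuous_id

lemma MeasLocBdd.integral_irwinHall_succ_mul {φ : ℝ → ℝ} (hφ : MeasLocBdd φ) (n : ℕ) :
    ∫ x, x * φ x ∂(irwinHall (n + 1))
      = ∫ y, y * ∫ u, φ (y + u) ∂unitUniform ∂(irwinHall n)
        + ∫ y, ∫ u, u * φ (y + u) ∂unitUniform ∂(irwinHall n) := by
  have hI := (hasZeroBias_irwinHall n).aeBounded
  have hU := hasZeroBias_unitUniform.aeBounded
  have hi₁ : Integrable (fun q : ℝ × ℝ => q.1 * φ (q.1 + q.2)) ((irwinHall n).prod unitUniform) :=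
    measLocBdd_id.integrable_mul hφ measurable_fst (measurable_fst.add measurable_snd)
      (hI.fst _) (hI.add_prod hU)
  have hi₂ : Integrable (fun q : ℝ × ℝ => q.2 * φ (q.1 + q.2)) ((irwinHall n).prod unitUniform) :=
    measLocBdd_id.integrable_mul hφ measurable_snd (measurable_fst.add measurable_snd)
      (hU.snd _) (hI.add_prod hU)
  have hi : Integrable (fun q : ℝ × ℝ => q.1 * φ (q.1 + q.2) + q.2 * φ (q.1 + q.2))
      ((irwinHall n).prod unitUniform) := hi₁.add hi₂
  rw [(measLocBdd_id.mul hφ).integral_irwinHall_succ]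
  simp only [add_mul]
  rw [← integral_prod _ hi, integral_add hi₁ hi₂, integral_prod _ hi₁, integral_prod _ hi₂]
  simp only [integral_const_mul]

/-- By exchangeability, each of the `n + 1` uniform variables contributes equally. -/
lemma integral_irwinHall_mul_eq (n : ℕ) {φ : ℝ → ℝ} (hφ : MeasLocBdd φ) :
    ∫ y, y * ∫ u, φ (y + u) ∂unitUniform ∂(irwinHall n)
      = n * ∫ y, ∫ u, u * φ (y + u) ∂unitUniform ∂(irwinHall n) := by
  induction n generalizing φ with
  | zero => simp [irwinHall]
  | succ n ih =>
    have hU := hasZeroBias_unitUniform.aeBounded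
    have hA : MeasLocBdd fun y => ∫ u, φ (y + u) ∂unitUniform := by
      simpa using hφ.average measLocBdd_one
    have hB := hφ.average measLocBdd_id
    rw [hA.integral_irwinHall_succ_mul, ih hA, hB.integral_irwinHall_succ, ← add_one_mul]
    push_cast
    congr 1
    refine integral_congr_ae (ae_of_all _ fun y => ?_)
    simp only [← integral_const_mul]
    -- The induction hypothesis leaves the last two uniform summands with exchanged roles; Fubini's
    -- theorem swaps them.
    rw [integral_integral_swap]
    · simp only [add_right_comm y]
    · have hb : ∃ R : ℝ, ∀ᵐ q ∂(unitUniform.prod unitUniform), |y + q.1 + q.2| ≤ R := by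
        obtain ⟨R, hR⟩ := hU.add_prod hU
        refine ⟨|y| + R, hR.mono fun q hq => ?_⟩
        rw [add_assoc]
        exact (abs_add_le _ _).trans (by linarith)
      exact measLocBdd_id.integrable_mul hφ measurable_fst (by fun_prop) (hU.fst _) hb

/-- As `u` crosses the unit interval, the integer part of `y + u` jumps once, at `1 - fract y`. -/
lemma integral_unitUniform_floor (y : ℝ) (F : ℤ → ℝ → ℝ) (hF : ∀ k, Continuous (F k)) :
    ∫ u, F ⌊y + u⌋ u ∂unitUniform
      = (∫ u in (0 : ℝ)..1 - Int.fract y, F ⌊y⌋ u)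
        + ∫ u in (1 - Int.fract y)..1, F (⌊y⌋ + 1) u := by
  have ht0 := Int.fract_nonneg y
  have ht1 := Int.fract_lt_one y
  have hy := Int.floor_add_fract y
  have h0 : (0 : ℝ) ≤ 1 - Int.fract y := by linarith
  have h1 : 1 - Int.fract y ≤ 1 := by linarith
  have e0 : EqOn (fun u => F ⌊y + u⌋ u) (F ⌊y⌋) (Ioo 0 (1 - Int.fract y)) := by
    intro u hu
    have : ⌊y + u⌋ = ⌊y⌋ := by
      rw [Int.floor_eq_iff]
      constructor <;> linarith [hu.1, hu.2]
    simp only [this]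
  have e1 : EqOn (fun u => F ⌊y + u⌋ u) (F (⌊y⌋ + 1)) (Ioo (1 - Int.fract y) 1) := by
    intro u hu
    have : ⌊y + u⌋ = ⌊y⌋ + 1 := by
      rw [Int.floor_eq_iff]
      push_cast
      constructor <;> linarith [hu.1, hu.2]
    simp only [this]
  rw [integral_unitUniform, ← intervalIntegral.integral_add_adjacent_intervals
      (b := 1 - Int.fract y), intervalIntegral.integral_congr_Ioo_of_le h0 e0,
    intervalIntegral.integral_congr_Ioo_of_le h1 e1]
  · refine ((hF ⌊y⌋).intervalIntegrable _ _).congr_uIoo ?_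
    rw [uIoo_of_le h0]
    exact e0.symm
  · refine ((hF (⌊y⌋ + 1)).intervalIntegrable _ _).congr_uIoo ?_
    rw [uIoo_of_le h1]
    exact e1.symm

lemma integral_unitUniform_comp_floor (y : ℝ) (g : ℤ → ℝ) :
    ∫ u, g ⌊y + u⌋ ∂unitUniform
      = (1 - Int.fract y) * g ⌊y⌋ + Int.fract y * g (⌊y⌋ + 1) := by
  rw [integral_unitUniform_floor y (fun k _ => g k) fun _ => continuous_const]
  simp

/-- The reflection of the unit interval that fixes `⌊y + u⌋` exchanges `u` and
`1 - fract (y + u)`. -/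
lemma integral_mul_comp_floor_eq (y : ℝ) (h : ℤ → ℝ) :
    ∫ u, u * h ⌊y + u⌋ ∂unitUniform
      = ∫ u, (1 - (y + u - ⌊y + u⌋)) * h ⌊y + u⌋ ∂unitUniform := by
  rw [integral_unitUniform_floor y (fun k u => u * h k) fun _ => by fun_prop,
    integral_unitUniform_floor y (fun k u => (1 - (y + u - k)) * h k) fun _ => by fun_prop]
  have hy : y = ⌊y⌋ + Int.fract y := (Int.floor_add_fract y).symm
  have e1 : ∀ k : ℤ, ∀ u : ℝ, 1 - (y + u - k) = (1 - y + k) - u := fun k u => by ring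
  simp only [intervalIntegral.integral_mul_const, e1,
    intervalIntegral.integral_comp_sub_left (fun x => x), integral_id]
  push_cast
  rw [show (⌊y⌋ : ℝ) = y - Int.fract y by linarith]
  ring

/-- Given its integer part, a sum of `n` independent uniform variables has mean
`n (⌊x⌋ + 1) / (n + 1)`. -/
lemma integral_irwinHall_floor_eq_zero (n : ℕ) (h : ℤ → ℝ) :
    ∫ x, (((n : ℝ) + 1) * x - n * (⌊x⌋ + 1)) * h ⌊x⌋ ∂(irwinHall n) = 0 := by
  cases n with
  | zero => simp [irwinHall]
  | succ n =>
    have hh : MeasLocBdd fun x => h ⌊x⌋ := .comp_floor h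
    have hfl : MeasLocBdd fun x => (⌊x⌋ : ℝ) := .comp_floor fun k => (k : ℝ)
    have hfr : MeasLocBdd fun x => (1 - (x - ⌊x⌋)) * h ⌊x⌋ := by
      have h1 : MeasLocBdd fun x => 1 - x := .of_continuous (by fun_prop)
      convert (h1.add hfl).mul hh using 3
      ring
    have hxh := measLocBdd_id.mul hh
    have e1 : ∫ x, x * h ⌊x⌋ ∂(irwinHall (n + 1))
        = (n + 1) * ∫ y, ∫ u, u * h ⌊y + u⌋ ∂unitUniform ∂(irwinHall n) := by
      rw [hh.integral_irwinHall_succ_mul, integral_irwinHall_mul_eq n hh, ← add_one_mul]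
    -- The reflection replaces the last summand by `1 - fract x`, so `e1` becomes a relation between
    -- `x` and `⌊x⌋` alone.
    simp only [integral_mul_comp_floor_eq] at e1
    rw [← hfr.integral_irwinHall_succ] at e1
    have e2 : ∀ x : ℝ, ((((n + 1 : ℕ) : ℝ) + 1) * x - ((n + 1 : ℕ) : ℝ) * (⌊x⌋ + 1)) * h ⌊x⌋
        = x * h ⌊x⌋ - (n + 1) * ((1 - (x - ⌊x⌋)) * h ⌊x⌋) := by
      intro x
      push_cast
      ring
    simp only [e2]
    rw [integral_sub (hxh.integrable_irwinHall _) ((hfr.integrable_irwinHall _).const_mul _),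
      integral_const_mul, e1, sub_self]

/-- The number of descents of a uniform permutation has the law of the integer part of a sum of
`n` independent uniform variables. -/
lemma integral_descents (n : ℕ) (g : ℤ → ℝ) :
    ∫ π, g (descents π) ∂(uniformPerm n) = ∫ x, g ⌊x⌋ ∂(irwinHall n) := by
  induction n generalizing g with
  | zero =>
    rw [integral_uniformPerm_zero, irwinHall, integral_dirac]
    simp [descents]
  | succ n ih =>
    rw [integral_uniformPerm_succ, (MeasLocBdd.comp_floor g).integral_irwinHall_succ]
    simp only [sum_descents_insertMax, integral_unitUniform_comp_floor]
    have h1 := ih fun k => (((k : ℝ) + 1) * g k + ((n : ℝ) - k) * g (k + 1)) / (n + 1)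
    simp only [Int.cast_natCast] at h1
    -- The two recurrences differ by `((n + 1) x - n (⌊x⌋ + 1)) h ⌊x⌋` for this `h`, whose integral
    -- vanishes.
    rw [h1, ← sub_eq_zero, ← neg_eq_zero,
      ← integral_irwinHall_floor_eq_zero n fun k => (g (k + 1) - g k) / (n + 1), neg_sub,
      ← integral_sub]
    · refine integral_congr_ae (ae_of_all _ fun x => ?_)
      have : (n : ℝ) + 1 ≠ 0 := by positivity
      simp only [Int.fract]
      field_simp
      ring
    · have hfr : MeasLocBdd fun x => Int.fract x :=
        .of_bounded measurable_fract (M := 1) fun x => by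
          rw [Int.abs_fract]
          exact (Int.fract_lt_one x).le
      have h1fr : MeasLocBdd fun x => 1 - Int.fract x :=
        .of_bounded (measurable_const.sub measurable_fract) (M := 1) fun x => by
          rw [abs_le]
          constructor <;> linarith [Int.fract_lt_one x, Int.fract_nonneg x]
      exact ((h1fr.mul (.comp_floor g)).add
        (hfr.mul (.comp_floor fun k => g (k + 1)))).integrable_irwinHall n
    · exact (MeasLocBdd.comp_floor fun k =>
        (((k : ℝ) + 1) * g k + ((n : ℝ) - k) * g (k + 1)) / (n + 1)).integrable_irwinHall n

/-! ### Normal approximation of the two statistics -/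

lemma measureReal_descents_le (n : ℕ) (r : ℝ) :
    (uniformPerm n).real {π | (descents π : ℝ) ≤ r} = (irwinHall n).real {x | (⌊x⌋ : ℝ) ≤ r} := by
  have h := integral_descents n fun k => ({k : ℤ | (k : ℝ) ≤ r}.indicator 1 k : ℝ)
  have hm : MeasurableSet {x : ℝ | (⌊x⌋ : ℝ) ≤ r} :=
    measurableSet_le (measurable_from_top.comp Int.measurable_floor) measurable_const
  rw [← integral_indicator_one (MeasurableSet.of_discrete), ← integral_indicator_one hm]
  simp only [indicator, mem_ofPred_eq, Int.cast_natCast, Pi.one_apply] at h ⊢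
  exact h

lemma measureReal_inversions_le (n : ℕ) (r : ℝ) :
    (uniformPerm n).real {π | (inversions π : ℝ) ≤ r} = (inversionLaw n).real (Iic r) := by
  have h := integral_inversions n (φ := (Iic r).indicator 1)
    (.of_bounded (measurable_one.indicator measurableSet_Iic) (M := 1) fun x => by
      by_cases hx : x ∈ Iic r <;> simp [hx])
  rw [← integral_indicator_one (MeasurableSet.of_discrete),
    ← integral_indicator_one measurableSet_Iic]
  exact h

lemma descents_normal_approximation {n : ℕ} (hn : 1 ≤ n) (x : ℝ) :
    |(uniformPerm n).real
        {π | ((descents π : ℝ) - ((n : ℝ) - 1) / 2) / √(((n : ℝ) + 1) / 12) ≤ x}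
      - stdNormalCDF x| ≤ 100 / √(n : ℝ) := by
  have hn1 : (1 : ℝ) ≤ n := by exact_mod_cast hn
  set s := √(((n : ℝ) + 1) / 12) with hs_def
  have hs : 0 < s := Real.sqrt_pos.mpr (by positivity)
  have hs2 : s ^ 2 = ((n : ℝ) + 1) / 12 := Real.sq_sqrt (by positivity)
  set r := ((n : ℝ) - 1) / 2 + s * x with hr
  have hset : {π : Equiv.Perm (Fin n) | ((descents π : ℝ) - ((n : ℝ) - 1) / 2) / s ≤ x}
      = {π | (descents π : ℝ) ≤ r} := by
    ext π
    simp only [mem_ofPred_eq, div_le_iff₀ hs, sub_le_iff_le_add]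
    rw [hr, mul_comm x, add_comm]
  rw [hset, measureReal_descents_le]
  have hlow : (irwinHall n).real (Iic r) ≤ (irwinHall n).real {x | (⌊x⌋ : ℝ) ≤ r} :=
    measureReal_mono fun y hy => (Int.floor_le y).trans hy
  have hupp : (irwinHall n).real {x | (⌊x⌋ : ℝ) ≤ r} ≤ (irwinHall n).real (Iic (r + 1)) := by
    refine measureReal_mono fun y (hy : (⌊y⌋ : ℝ) ≤ r) => ?_
    have := Int.lt_floor_add_one y
    exact (by linarith : y ≤ r + 1)
  -- The sum has variance `n / 12`, whereas `s ^ 2 = (n + 1) / 12`; the bound allows this excess.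
  have hbe (z : ℝ) := (hasZeroBias_irwinHall n).abs_measureReal_Iic_sub_le zero_le_one
    (by positivity) hs (by rw [hs2]; linarith) z
  -- Removing the integer part moves the threshold by at most `1`. The means differ by `1 / 2`, so
  -- the two thresholds lie symmetrically at `x ± 1 / (2 s)`.
  have e1 : r = (n : ℝ) / 2 + s * (x - 1 / 2 * (1 / s)) := by
    rw [hr]
    field_simp
    ring
  have e2 : r + 1 = (n : ℝ) / 2 + s * (x + 1 / 2 * (1 / s)) := by
    rw [hr]
    field_simp
    ring
  have h1 := (abs_le.mp (hbe (x - 1 / 2 * (1 / s)))).1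
  have h2 := (abs_le.mp (hbe (x + 1 / 2 * (1 / s)))).2
  rw [← e1] at h1
  rw [← e2] at h2
  have hs1 : 0 < 1 / s := by positivity
  have d1 := stdNormalCDF_le_add (a := x - 1 / 2 * (1 / s)) (b := x) (by linarith)
  have d2 := stdNormalCDF_le_add (a := x) (b := x + 1 / 2 * (1 / s)) (by linarith)
  have hq : 0 < √(n : ℝ) := Real.sqrt_pos.mpr (by positivity)
  have hq2 : √(n : ℝ) ^ 2 = n := Real.sq_sqrt (by positivity)
  have b1 : 1 / s ≤ 4 / √(n : ℝ) := by
    rw [div_le_div_iff₀ hs hq, one_mul]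
    refine abs_le_of_sq_le_sq' ?_ (by positivity) |>.2
    rw [mul_pow, hs2, hq2]
    linarith
  have b2 : (s ^ 2 - (n : ℝ) / 12) / s ^ 2 ≤ 1 / √(n : ℝ) := by
    rw [hs2, div_le_div_iff₀ (by positivity) hq]
    nlinarith
  have b3 : 100 / √(n : ℝ) = 25 * (4 / √(n : ℝ)) := by ring
  have b4 : 1 / √(n : ℝ) = 1 / 4 * (4 / √(n : ℝ)) := by ring
  rw [abs_le]
  constructor <;> linarith

lemma inversions_normal_approximation {n : ℕ} (hn : 2 ≤ n) (x : ℝ) :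
    |(uniformPerm n).real
        {π | ((inversions π : ℝ) - (n.choose 2 : ℝ) / 2)
            / √((n : ℝ) * ((n : ℝ) - 1) * (2 * (n : ℝ) + 5) / 72) ≤ x}
      - stdNormalCDF x| ≤ 100 / √(n : ℝ) := by
  have hn2 : (2 : ℝ) ≤ n := by exact_mod_cast hn
  have hv : 0 < (n : ℝ) * ((n : ℝ) - 1) * (2 * (n : ℝ) + 5) / 72 := by
    have : (0 : ℝ) < n - 1 := by linarith
    positivity
  set s := √((n : ℝ) * ((n : ℝ) - 1) * (2 * (n : ℝ) + 5) / 72)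
  have hs : 0 < s := Real.sqrt_pos.mpr hv
  have hs2 : s ^ 2 = (n : ℝ) * ((n : ℝ) - 1) * (2 * (n : ℝ) + 5) / 72 := Real.sq_sqrt hv.le
  have hset : {π : Equiv.Perm (Fin n) | ((inversions π : ℝ) - (n.choose 2 : ℝ) / 2) / s ≤ x}
      = {π | (inversions π : ℝ) ≤ (n : ℝ) * (n - 1) / 4 + s * x} := by
    ext π
    simp only [mem_ofPred_eq, div_le_iff₀ hs, sub_le_iff_le_add, Nat.cast_choose_two]
    rw [mul_comm x, add_comm, div_div]
    norm_num
  rw [hset, measureReal_inversions_le]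
  refine ((hasZeroBias_inversionLaw n).abs_measureReal_Iic_sub_le (by positivity) hv hs hs2.ge
    x).trans ?_
  rw [hs2, sub_self, zero_div, mul_zero, add_zero]
  have hq : 0 < √(n : ℝ) := Real.sqrt_pos.mpr (by positivity)
  have hq2 : √(n : ℝ) ^ 2 = n := Real.sq_sqrt (by positivity)
  have b1 : (n : ℝ) / s ≤ 9 / √(n : ℝ) := by
    rw [div_le_div_iff₀ hs hq]
    refine abs_le_of_sq_le_sq' ?_ (by positivity) |>.2
    rw [mul_pow, mul_pow, hs2, hq2]
    have : (n : ℝ) * n ≤ (n - 1) * (2 * n + 5) := by nlinarith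
    nlinarith
  have b3 : 100 / √(n : ℝ) = 9 * (9 / √(n : ℝ)) + 19 / √(n : ℝ) := by ring
  have : 0 ≤ 19 / √(n : ℝ) := by positivity
  linarith

theorem theorem2 :
    ∃ C : ℝ, ∀ n : ℕ, 1 ≤ n →
      (∀ x : ℝ,
        |(uniformPerm n).real
            {π | ((descents π : ℝ) - ((n : ℝ) - 1) / 2) / √(((n : ℝ) + 1) / 12) ≤ x}
          - stdNormalCDF x| ≤ C / √(n : ℝ)) ∧
      (2 ≤ n → ∀ x : ℝ,
        |(uniformPerm n).real
            {π | ((inversions π : ℝ) - (n.choose 2 : ℝ) / 2)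
                / √((n : ℝ) * ((n : ℝ) - 1) * (2 * (n : ℝ) + 5) / 72) ≤ x}
          - stdNormalCDF x| ≤ C / √(n : ℝ)) := by
  -- The estimates give `9.5 * 4 + 2 = 40` for descents and `9 * 9 = 81` for inversions; `100`
  -- covers both.
  exact ⟨100, fun n hn => ⟨descents_normal_approximation hn,
    fun hn2 => inversions_normal_approximation hn2⟩⟩
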